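/- Let $d\ge 1$, let $\nu$ be a fixed probability measure on $\mathbb R^d$ with $\int |x|\,\nu(dx)<\infty$, and let $\mathbf c=(c_0,\dots,c_d)\in(0,\infty)^{d+1}$ satisfy $\sum_{i=1}^d c_i<1$. Let $\Phi$ be a set of measurable functions $\varphi:\mathbb R^d\to\mathbb R$ with $\|\varphi\|_{L^2([0,1]^d)}=1$, let $n_s\ge 1$ be an integer and $C\ge 1$. Let $\mathcal M=\mathcal M^0_\Phi(\mathbf c,n_s,C)$ be the set of all measurable $m:\mathbb R^d\to\mathbb R$ such that $|m(x)|\le c_0+\sum_{i=1}^d c_i|x_i|$ for all $x\in\mathbb R^d$ and $$m(x)=\sum_{i=1}^{n_s}\theta_i\,\varphi_i(A_ix-b_i)$$ for some $\varphi_i\in\Phi$, invertible $A_i\in\mathbb R^{d\times d}$, $b_i\in\mathbb R^d$, $\theta_i\in\mathbb R$ with $\max\{|\det A_i|^{-1},|A_i|_\infty,|b_i|_\infty,|\theta_i|\}\le C$, where $|\cdot|_\infty$ is the maximum of the absolute values of the entries. For $m\in\mathcal M$ consider the Gaussian nonlinear AR($d$) model $$Y_t=m(Y_{t-1},\dots,Y_{t-d})+v_t,\qquad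 t=1,\dots,T,$$ where $(Y_0,Y_{-1},\dots,Y_{-d+1})\sim\nu$ is independent of the i.i.d. $N(0,1)$ variables $v_1,\dots,v_T$. Put $X_t=(Y_{t-1},\dots,Y_{t-d})$ and $f_0=m\mathbf 1_{[0,1]^d}$. An estimator $\hat f_T$ is a real-valued function of $(Y_{-d+1},\dots,Y_T)$ and $x\in\mathbb R^d$ that is jointly measurable in both; its risk is $$R(\hat f_T,f_0)=\mathrm E\Big[\frac1T\sum_{t=1}^T\big(\hat f_T(X_t^*)-f_0(X_t^*)\big)^2\Big]\in[0,\infty],$$ where $(X_t^*)_{t=1}^T$ is an independent copy of $(X_t)_{t=1}^T$, independent of the observations. Suppose that there is a $\varphi\in\Phi$ with $\operatorname{supp}(\varphi)\subset[0,1]^d$ and $\sup_{x\in[0,1]^d}|\varphi(x)|\le c_0$. Then $$\liminf_{T\to\infty}\;T\,\inf_{\hat f_T}\,\sup_{m\in\mathcal M}R(\hat f_T,f_0)>0,$$ where the infimum is over all estimators $\hat f_T$. -/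

import Mathlib

open MeasureTheory ProbabilityTheory Filter Matrix
open scoped ENNReal

noncomputable section

namespace NonlinearAR

/-- A stretch `(Y_{1-d}, …, Y_0, Y_1, …, Y_T)` of the time series.  The first component `x₀` holds
the initial values in the order `x₀ i = Y_{-i}`, i.e. `x₀ = (Y_0, Y_{-1}, …, Y_{-d+1})`; the second
component `y` holds `y t = Y_{t+1}` for `t = 0, …, T-1`. -/
abbrev Sample (d T : ℕ) : Type := (Fin d → ℝ) × (Fin T → ℝ)

/-- The regressor `X_{t+1} = (Y_t, Y_{t-1}, …, Y_{t+1-d})`: its `i`-th entry is `Y_{t-i}`, which is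
`y (t-1-i)` if `i < t` and the initial value `x₀ (i-t)` otherwise. -/
def lag {d T : ℕ} (z : Sample d T) (t : Fin T) : Fin d → ℝ := fun i =>
  if _h : i.val < t.val then z.2 ⟨t.val - 1 - i.val, by have := t.isLt; omega⟩
  else z.1 ⟨i.val - t.val, by have := i.isLt; omega⟩

/-- The solution `Y_{t+1}`, `t = 0, …, T-1`, of the recursion `Y_{t+1} = m(Y_t, …, Y_{t+1-d}) + v_{t+1}`
with initial values `x₀` and noise `v` (where `v t` stands for `v_{t+1}`); see `path_eq`. -/
def path {d T : ℕ} (m : (Fin d → ℝ) → ℝ) (x₀ : Fin d → ℝ) (v : Fin T → ℝ) (t : Fin T) : ℝ :=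
  m (fun i : Fin d =>
    if _h : i.val < t.val then path m x₀ v ⟨t.val - 1 - i.val, by have := t.isLt; omega⟩
    else x₀ ⟨i.val - t.val, by have := i.isLt; omega⟩) + v t
termination_by t.val
decreasing_by omega

/-- The defining equation `Y_t = m(X_t) + v_t` of the autoregression. -/
theorem path_eq {d T : ℕ} (m : (Fin d → ℝ) → ℝ) (x₀ : Fin d → ℝ) (v : Fin T → ℝ) (t : Fin T) :
    path m x₀ v t = m (lag (x₀, path m x₀ v) t) + v t := by
  rw [path]
  rfl

/-- The law `P_{m,T}` of `(Y_{1-d}, …, Y_T)` when the initial vector has law `ν` and is independent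
of the i.i.d. standard normal noise `v_1, …, v_T`. -/
def law {d : ℕ} (ν : Measure (Fin d → ℝ)) (m : (Fin d → ℝ) → ℝ) (T : ℕ) : Measure (Sample d T) :=
  (ν.prod (Measure.pi fun _ : Fin T => gaussianReal 0 1)).map fun ω => (ω.1, path m ω.1 ω.2)

/-- The unit cube `[0,1]^d`. -/
def cube (d : ℕ) : Set (Fin d → ℝ) := Set.Icc 0 1

/-- The target `f₀ = m 1_{[0,1]^d}`. -/
def target {d : ℕ} (m : (Fin d → ℝ) → ℝ) : (Fin d → ℝ) → ℝ := (cube d).indicator m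

/-- An estimator of a function on `ℝ^d`, based on the observed stretch of the time series: jointly
measurable in the observations and in the argument of the function. -/
def IsEstimator {d T : ℕ} (f : Sample d T → (Fin d → ℝ) → ℝ) : Prop :=
  Measurable (Function.uncurry f)

/-- The generalization error `R(f̂, f₀) = E[T⁻¹ ∑_{t=1}^T (f̂(X*_t) - f₀(X*_t))²]`, where the
estimator is computed from `p.1` and `X*` from the independent copy `p.2`. -/
def risk {d : ℕ} (ν : Measure (Fin d → ℝ)) (m : (Fin d → ℝ) → ℝ) {T : ℕ}
    (f : Sample d T → (Fin d → ℝ) → ℝ) : ℝ≥0∞ :=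
  ∫⁻ p, (T : ℝ≥0∞)⁻¹ *
    ∑ t : Fin T, ENNReal.ofReal ((f p.1 (lag p.2 t) - target m (lag p.2 t)) ^ 2)
    ∂((law ν m T).prod (law ν m T))

/-- The minimax risk `inf_{f̂} sup_{m ∈ M} R(f̂, f₀)` for samples of length `T`. -/
def minimaxRisk {d : ℕ} (ν : Measure (Fin d → ℝ)) (M : Set ((Fin d → ℝ) → ℝ)) (T : ℕ) : ℝ≥0∞ :=
  ⨅ (f : Sample d T → (Fin d → ℝ) → ℝ) (_ : IsEstimator f), ⨆ m ∈ M, risk ν m f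

/-- The class `M₀(c)`: measurable `m` with `|m(x)| ≤ c₀ + ∑_{i=1}^d c_i |x_i|`. -/
def growthClass {d : ℕ} (c : Fin (d + 1) → ℝ) : Set ((Fin d → ℝ) → ℝ) :=
  {m | Measurable m ∧ ∀ x, |m x| ≤ c 0 + ∑ i : Fin d, c i.succ * |x i|}

/-- The `ℓ⁰`-bounded affine class: sums of `n` terms `θ_i φ_i(A_i x - b_i)` with `φ_i ∈ Φ` and
`|det A_i|⁻¹ ∨ |A_i|_∞ ∨ |b_i|_∞ ∨ |θ_i| ≤ C` (entrywise maximum norms); a singular `A_i` is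
excluded. -/
def affineClass {d : ℕ} (Φ : Set ((Fin d → ℝ) → ℝ)) (n : ℕ) (C : ℝ) : Set ((Fin d → ℝ) → ℝ) :=
  {m | ∃ (A : Fin n → Matrix (Fin d) (Fin d) ℝ) (b : Fin n → Fin d → ℝ) (θ : Fin n → ℝ)
      (φ : Fin n → (Fin d → ℝ) → ℝ),
    (∀ i, φ i ∈ Φ ∧ (A i).det ≠ 0 ∧ |(A i).det|⁻¹ ≤ C ∧ (∀ j k, |A i j k| ≤ C) ∧
      (∀ j, |b i j| ≤ C) ∧ |θ i| ≤ C) ∧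
    m = fun x => ∑ i, θ i * φ i (A i *ᵥ x - b i)}

/-- The class `M⁰_Φ(c, n, C) = M₀(c) ∩ I⁰_Φ(n, C)`. -/
def modelClass {d : ℕ} (Φ : Set ((Fin d → ℝ) → ℝ)) (c : Fin (d + 1) → ℝ) (n : ℕ) (C : ℝ) :
    Set ((Fin d → ℝ) → ℝ) :=
  growthClass c ∩ affineClass Φ n C

end NonlinearAR

end

namespace NonlinearAR

/-! ### Resampling one coordinate of a product measure -/

/-! The proof is Le Cam's two-point method. The competing regression functions are `0` and `T^{-1/2}
φ`; both lie in the class, and their squared `L²([0,1]^d)` distance is `1/T`.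

Such a perturbation is too small to detect. Relative to the model with `m = 0`, in which the
observations are the noise itself, the likelihood ratio `L` of the other model is a product of `T`
Gaussian tilts with exponents at most `c₀ / √T` in modulus. Hence `E L² ≤ exp(c₀²)`
(`lintegral_likelihoodRatio_sq_le`), which keeps `E min(1, L)` away from zero
(`le_lintegral_min_likelihoodRatio`). No estimate can be close to both functions, so the two
expected cube errors add up to at least `E min(1, L) / (2T)`.

The risk averages over the law of the regressors rather than over Lebesgue measure. Given the past,
each new value is `N(a, 1)` with `|a| ≤ c₀`, whose density on `[0,1]` is at least `pdfBound c₀`.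
After `d` steps the whole regressor vector has been renewed, so its law dominates `pdfBound c₀ ^ d`
times Lebesgue measure on the cube (`le_lintegral_lag`). All of this holds for every fixed initial
vector and is then integrated against `ν`. -/

/-- This serves as conditioning on all noise variables but one: the inner integral may be computed
with the other coordinates frozen, without splitting the product space. -/
theorem lintegral_pi_update {ι : Type*} [Fintype ι] [DecidableEq ι] (ρ : Measure ℝ)
    [IsProbabilityMeasure ρ] (k : ι) {F : (ι → ℝ) → ℝ≥0∞} (hF : Measurable F) :
    ∫⁻ v, ∫⁻ w, F (Function.update v k w) ∂ρ ∂(Measure.pi fun _ : ι => ρ)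
      = ∫⁻ v, F v ∂(Measure.pi fun _ : ι => ρ) := by
  have hu : Measurable fun p : (ι → ℝ) × ℝ => Function.update p.1 k p.2 := by
    refine measurable_pi_iff.2 fun i => ?_
    by_cases h : i = k
    · subst h; simpa using measurable_snd
    · simp only [Function.update_of_ne h]; fun_prop
  refine lintegral_eq_of_lmarginal_eq {k} ?_ hF ?_
  · exact (hF.comp hu).lintegral_prod_right'
  · ext x
    simp [lmarginal_singleton, Function.update_idem]

/-! ### The standard Gaussian measure under shifts -/

/-- The density of `N(a, 1)` with respect to `N(0, 1)`. -/
noncomputable def tilt (a w : ℝ) : ℝ≥0∞ := ENNReal.ofReal (Real.exp (a * w - a ^ 2 / 2))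

theorem measurable_tilt : Measurable fun p : ℝ × ℝ => tilt p.1 p.2 := by
  unfold tilt; fun_prop

theorem measurable_tilt_right (a : ℝ) : Measurable (tilt a) := by
  unfold tilt; fun_prop

theorem lintegral_gaussian_shift_eq_pdf (a : ℝ) {f : ℝ → ℝ≥0∞} (hf : Measurable f) :
    ∫⁻ w, f (a + w) ∂(gaussianReal 0 1) = ∫⁻ w, gaussianPDF a 1 w * f w := by
  rw [← lintegral_map (f := f) (g := fun w => a + w) hf (by fun_prop), gaussianReal_map_const_add,
    zero_add, gaussianReal_of_var_ne_zero _ one_ne_zero,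
    lintegral_withDensity_eq_lintegral_mul _ (measurable_gaussianPDF _ _) hf]
  rfl

theorem lintegral_gaussian_shift (a : ℝ) {f : ℝ → ℝ≥0∞} (hf : Measurable f) :
    ∫⁻ w, f (a + w) ∂(gaussianReal 0 1) = ∫⁻ w, f w * tilt a w ∂(gaussianReal 0 1) := by
  rw [lintegral_gaussian_shift_eq_pdf a hf, gaussianReal_of_var_ne_zero _ one_ne_zero,
    lintegral_withDensity_eq_lintegral_mul _ (measurable_gaussianPDF _ _)
      (g := fun w => f w * tilt a w) (hf.mul (measurable_tilt_right a))]
  refine lintegral_congr fun w => ?_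
  have : gaussianPDF a 1 w = gaussianPDF 0 1 w * tilt a w := by
    rw [gaussianPDF, gaussianPDF, tilt, ← ENNReal.ofReal_mul (gaussianPDFReal_nonneg _ _ _)]
    congr 1
    rw [gaussianPDFReal, gaussianPDFReal, mul_assoc (√_)⁻¹, ← Real.exp_add]
    congr 2
    simp only [NNReal.coe_one]
    ring
  simp only [Pi.mul_apply]
  rw [this]; ring

theorem lintegral_tilt (a : ℝ) : ∫⁻ w, tilt a w ∂(gaussianReal 0 1) = 1 := by
  simpa using (lintegral_gaussian_shift a (f := fun _ => 1) measurable_const).symm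

/-- Squaring doubles the shift: `2aw - a² = a² + (2aw - (2a)²/2)`, and a tilt has mean one. -/
theorem lintegral_tilt_sq (a : ℝ) :
    ∫⁻ w, tilt a w ^ 2 ∂(gaussianReal 0 1) = ENNReal.ofReal (Real.exp (a ^ 2)) := by
  have (w : ℝ) : tilt a w ^ 2 = ENNReal.ofReal (Real.exp (a ^ 2)) * tilt (2 * a) w := by
    rw [tilt, tilt, ← ENNReal.ofReal_pow (Real.exp_nonneg _), ← Real.exp_nat_mul,
      ← ENNReal.ofReal_mul (Real.exp_nonneg _), ← Real.exp_add]
    congr 2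
    push_cast
    ring
  simp_rw [this]
  rw [lintegral_const_mul _ (measurable_tilt_right _), lintegral_tilt, mul_one]

/-- A lower bound on `[0,1]` for the densities of `N(a, 1)` with `|a| ≤ B`. -/
noncomputable def pdfBound (B : ℝ) : ℝ≥0∞ :=
  ENNReal.ofReal ((√(2 * Real.pi))⁻¹ * Real.exp (-(1 + B) ^ 2 / 2))

theorem pdfBound_pos (B : ℝ) : 0 < pdfBound B := by
  unfold pdfBound
  rw [ENNReal.ofReal_pos]
  positivity

theorem pdfBound_le {a B w : ℝ} (ha : |a| ≤ B) (hw : w ∈ Set.Icc (0 : ℝ) 1) :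
    pdfBound B ≤ gaussianPDF a 1 w := by
  rw [pdfBound, gaussianPDF, gaussianPDFReal]
  simp only [NNReal.coe_one, mul_one]
  have := abs_le.1 ha
  have : (w - a) ^ 2 ≤ (1 + B) ^ 2 := sq_le_sq' (by linarith [hw.1]) (by linarith [hw.2])
  gcongr

theorem le_lintegral_gaussian_shift {a B : ℝ} (ha : |a| ≤ B) {f : ℝ → ℝ≥0∞} (hf : Measurable f) :
    pdfBound B * ∫⁻ w in Set.Icc 0 1, f w ≤ ∫⁻ w, f (a + w) ∂(gaussianReal 0 1) := by
  rw [lintegral_gaussian_shift_eq_pdf a hf, ← lintegral_const_mul _ hf]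
  refine (setLIntegral_mono' measurableSet_Icc fun w hw => ?_).trans
    (setLIntegral_le_lintegral (Set.Icc 0 1) _)
  gcongr
  exact pdfBound_le ha hw

/-! ### Measurability and causality of the autoregression -/

variable {d T : ℕ}

theorem measurable_lag (t : Fin T) : Measurable fun z : Sample d T => lag z t := by
  refine measurable_pi_iff.2 fun i => ?_
  unfold lag
  split_ifs <;> fun_prop

theorem lag_congr {x : Fin d → ℝ} {y y' : Fin T → ℝ} {t : Fin T}
    (h : ∀ s < t, y s = y' s) : lag (x, y) t = lag (x, y') t := by
  ext i
  unfold lag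
  split_ifs with hi
  · exact h _ (Fin.lt_def.2 (by simp only; omega))
  · rfl

theorem lag_update (x : Fin d → ℝ) (y : Fin T → ℝ) {s t : Fin T} (h : t ≤ s) (w : ℝ) :
    lag (x, Function.update y s w) t = lag (x, y) t :=
  lag_congr fun _ hr => Function.update_of_ne (hr.trans_le h).ne _ _

theorem measurable_path_apply {m : (Fin d → ℝ) → ℝ} (hm : Measurable m) (t : Fin T) :
    Measurable fun p : (Fin d → ℝ) × (Fin T → ℝ) => path m p.1 p.2 t := by
  induction t using WellFoundedLT.induction with
  | ind t ih =>
    -- The regressor at `t` reads no value from time `t` on. Zeroing those leaves only coordinates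
    -- covered by the induction hypothesis.
    have key : (fun p : (Fin d → ℝ) × (Fin T → ℝ) => path m p.1 p.2 t) = fun p =>
        m (lag (p.1, fun s => if s < t then path m p.1 p.2 s else 0) t) + p.2 t := by
      ext p
      rw [path_eq, lag_congr (y' := fun s => if s < t then path m p.1 p.2 s else 0)]
      intro s hs
      simp [hs]
    rw [key]
    refine (hm.comp ((measurable_lag t).comp (measurable_fst.prodMk
      (measurable_pi_iff.2 fun s => ?_)))).add (by fun_prop)
    by_cases hs : s < t
    · simpa [hs] using ih s hs
    · simp [hs]

theorem measurable_path {m : (Fin d → ℝ) → ℝ} (hm : Measurable m) :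
    Measurable fun p : (Fin d → ℝ) × (Fin T → ℝ) => path m p.1 p.2 :=
  measurable_pi_iff.2 (measurable_path_apply hm)

theorem path_update (m : (Fin d → ℝ) → ℝ) (x : Fin d → ℝ) (v : Fin T → ℝ) (w : ℝ) (s t : Fin T)
    (h : t < s) : path m x (Function.update v s w) t = path m x v t := by
  induction t using WellFoundedLT.induction with
  | ind t ih =>
    rw [path_eq, path_eq, Function.update_of_ne h.ne]
    congr 2
    exact lag_congr fun r hr => ih r hr (hr.trans h)

theorem path_zero (x : Fin d → ℝ) (v : Fin T → ℝ) : path (fun _ => 0) x v = v := by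
  ext t
  rw [path_eq, zero_add]

/-! ### The likelihood ratio with respect to the model with `m = 0` -/

/-- The first `k` values of the autoregression, followed by the remaining noise variables. -/
noncomputable def partialPath (m : (Fin d → ℝ) → ℝ) (x : Fin d → ℝ) (k : ℕ) (v : Fin T → ℝ)
    (i : Fin T) : ℝ :=
  if i.val < k then path m x v i else v i

/-- The likelihood ratio of the first `k` values with respect to standard Gaussian noise. -/
noncomputable def likelihoodRatio (m : (Fin d → ℝ) → ℝ) (k : ℕ) (z : Sample d T) : ℝ≥0∞ :=
  ∏ t with t.val < k, tilt (m (lag z t)) (z.2 t)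

theorem measurable_likelihoodRatio {m : (Fin d → ℝ) → ℝ} (hm : Measurable m) (k : ℕ) :
    Measurable (likelihoodRatio (T := T) m k) :=
  Finset.measurable_prod _ fun t _ => measurable_tilt.comp
    ((hm.comp (measurable_lag t)).prodMk (by fun_prop))

theorem partialPath_succ (m : (Fin d → ℝ) → ℝ) (x : Fin d → ℝ) (k : Fin T) (v : Fin T → ℝ) :
    partialPath m x (k + 1) v = Function.update (partialPath m x k v) k
      (m (lag (x, partialPath m x k v) k) + partialPath m x k v k) := by
  ext i
  by_cases h : i = k
  · subst h
    rw [Function.update_self]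
    simp only [partialPath, Nat.lt_succ_self, if_true, lt_irrefl, if_false]
    rw [path_eq]
    congr 2
    exact lag_congr fun s hs => (if_pos (Fin.lt_def.1 hs)).symm
  · rw [Function.update_of_ne h]
    have : i.val ≠ k.val := fun e => h (Fin.ext e)
    simp only [partialPath]
    congr 1
    exact propext ⟨fun _ => by omega, fun _ => by omega⟩

theorem likelihoodRatio_succ (m : (Fin d → ℝ) → ℝ) (k : Fin T) (z : Sample d T) :
    likelihoodRatio m (k + 1) z = likelihoodRatio m k z * tilt (m (lag z k)) (z.2 k) := by
  have : Finset.univ.filter (fun t : Fin T => t.val < k.val + 1)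
      = insert k (Finset.univ.filter fun t : Fin T => t.val < k.val) := by
    ext t
    simp only [Finset.mem_filter, Finset.mem_univ, true_and, Finset.mem_insert, Fin.ext_iff]
    omega
  rw [likelihoodRatio, this, Finset.prod_insert (by simp), mul_comm]
  rfl

theorem likelihoodRatio_update (m : (Fin d → ℝ) → ℝ) (k : Fin T) (x : Fin d → ℝ) (y : Fin T → ℝ)
    (w : ℝ) : likelihoodRatio m k (x, Function.update y k w) = likelihoodRatio m k (x, y) := by
  refine Finset.prod_congr rfl fun t ht => ?_
  have ht : t < k := by simpa using ht
  rw [lag_update _ _ ht.le]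
  simp only
  rw [Function.update_of_ne ht.ne]

/-- A discrete Girsanov formula, proved by turning noise variables into observations one at a time.
The `k`-th change shifts coordinate `k` by a function of the earlier coordinates only, so it is a
one-dimensional Gaussian shift given the rest. -/
theorem lintegral_partialPath {m : (Fin d → ℝ) → ℝ} (hm : Measurable m) (x : Fin d → ℝ) (k : ℕ)
    (hk : k ≤ T) {G : (Fin T → ℝ) → ℝ≥0∞} (hG : Measurable G) :
    ∫⁻ v, G (partialPath m x k v) ∂(Measure.pi fun _ : Fin T => gaussianReal 0 1)
      = ∫⁻ v, G v * likelihoodRatio m k (x, v) ∂(Measure.pi fun _ : Fin T => gaussianReal 0 1) := by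
  induction k generalizing G with
  | zero =>
    have h0 (v : Fin T → ℝ) : partialPath m x 0 v = v := by ext; simp [partialPath]
    simp [h0, likelihoodRatio]
  | succ k ih =>
    have hL (k : ℕ) : Measurable fun v : Fin T → ℝ => likelihoodRatio m k (x, v) :=
      (measurable_likelihoodRatio hm k).comp measurable_prodMk_left
    have hlag (t : Fin T) : Measurable fun v : Fin T → ℝ => m (lag (x, v) t) :=
      hm.comp ((measurable_lag t).comp measurable_prodMk_left)
    let κ : Fin T := ⟨k, hk⟩
    let Ψ : (Fin T → ℝ) → (Fin T → ℝ) := fun y => Function.update y κ (m (lag (x, y) κ) + y κ)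
    have hΨ : Measurable Ψ := by
      refine measurable_pi_iff.2 fun i => ?_
      by_cases h : i = κ
      · subst h
        simp only [Ψ, Function.update_self]
        exact (hlag _).add (measurable_pi_apply _)
      · simpa [Ψ, Function.update_of_ne h] using measurable_pi_apply i
    have h1 (v : Fin T → ℝ) : partialPath m x (k + 1) v = Ψ (partialPath m x k v) :=
      partialPath_succ m x κ v
    simp_rw [h1]
    rw [show (∫⁻ v, G (Ψ (partialPath m x k v)) ∂(Measure.pi fun _ : Fin T => gaussianReal 0 1))
        = ∫⁻ v, (G ∘ Ψ) (partialPath m x k v) ∂(Measure.pi fun _ : Fin T => gaussianReal 0 1)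
        from rfl, ih (by omega) (hG.comp hΨ),
      ← lintegral_pi_update _ κ (F := fun v => (G ∘ Ψ) v * likelihoodRatio m k (x, v))
        ((hG.comp hΨ).mul (hL k)),
      ← lintegral_pi_update _ κ (F := fun v => G v * likelihoodRatio m (k + 1) (x, v))
        (hG.mul (hL (k + 1)))]
    -- With `v` frozen and coordinate `κ` resampled as `w`, the drift and the first `k` factors of
    -- the likelihood ratio do not depend on `w`.
    refine lintegral_congr fun v => ?_
    have h2 (w : ℝ) : (G ∘ Ψ) (Function.update v κ w)
        = G (Function.update v κ (m (lag (x, v) κ) + w)) := by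
      simp only [Ψ, Function.comp_apply, Function.update_idem, Function.update_self]
      rw [lag_update _ _ le_rfl]
    have h3 (w : ℝ) : likelihoodRatio m k (x, Function.update v κ w) = likelihoodRatio m k (x, v) :=
      likelihoodRatio_update m κ x v w
    have h4 (w : ℝ) : likelihoodRatio m (k + 1) (x, Function.update v κ w)
        = likelihoodRatio m k (x, v) * tilt (m (lag (x, v) κ)) w := by
      rw [show k + 1 = κ.val + 1 from rfl, likelihoodRatio_succ, likelihoodRatio_update,
        lag_update _ _ le_rfl]
      simp [κ]
    have hGu : Measurable fun w : ℝ => G (Function.update v κ w) :=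
      hG.comp (measurable_update v)
    simp only [h2, h3, h4]
    rw [lintegral_gaussian_shift (m (lag (x, v) κ)) (hGu.mul_const _)]
    refine lintegral_congr fun w => ?_
    ring

theorem lintegral_path {m : (Fin d → ℝ) → ℝ} (hm : Measurable m) (x : Fin d → ℝ)
    {G : (Fin T → ℝ) → ℝ≥0∞} (hG : Measurable G) :
    ∫⁻ v, G (path m x v) ∂(Measure.pi fun _ : Fin T => gaussianReal 0 1)
      = ∫⁻ v, G v * likelihoodRatio m T (x, v) ∂(Measure.pi fun _ : Fin T => gaussianReal 0 1) := by
  rw [← lintegral_partialPath hm x T le_rfl hG]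
  have hT (v : Fin T → ℝ) : partialPath m x T v = path m x v := by ext; simp [partialPath]
  simp_rw [hT]

/-- Given the past, the newest factor has second moment `exp(m(X)²) ≤ exp B`, so each step costs at
most one factor `exp B`. -/
theorem lintegral_likelihoodRatio_sq_le {m : (Fin d → ℝ) → ℝ} (hm : Measurable m) {B : ℝ}
    (hB : ∀ x, m x ^ 2 ≤ B) (x : Fin d → ℝ) (k : ℕ) (hk : k ≤ T) :
    ∫⁻ v, likelihoodRatio m k (x, v) ^ 2 ∂(Measure.pi fun _ : Fin T => gaussianReal 0 1)
      ≤ ENNReal.ofReal (Real.exp B) ^ k := by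
  have hL (k : ℕ) : Measurable fun v : Fin T → ℝ => likelihoodRatio m k (x, v) :=
    (measurable_likelihoodRatio hm k).comp measurable_prodMk_left
  induction k with
  | zero => simp [likelihoodRatio]
  | succ k ih =>
    let κ : Fin T := ⟨k, hk⟩
    have h4 (v : Fin T → ℝ) (w : ℝ) : likelihoodRatio m (k + 1) (x, Function.update v κ w)
        = likelihoodRatio m k (x, v) * tilt (m (lag (x, v) κ)) w := by
      rw [show k + 1 = κ.val + 1 from rfl, likelihoodRatio_succ, likelihoodRatio_update,
        lag_update _ _ le_rfl]
      simp [κ]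
    rw [← lintegral_pi_update _ κ ((hL (k + 1)).pow_const 2)]
    simp_rw [h4, mul_pow]
    calc _ = ∫⁻ v, likelihoodRatio m k (x, v) ^ 2 * ENNReal.ofReal (Real.exp (m (lag (x, v) κ) ^ 2))
            ∂(Measure.pi fun _ : Fin T => gaussianReal 0 1) := by
          refine lintegral_congr fun v => ?_
          rw [lintegral_const_mul _
            ((measurable_tilt_right _).pow_const 2), lintegral_tilt_sq]
      _ ≤ ∫⁻ v, likelihoodRatio m k (x, v) ^ 2 * ENNReal.ofReal (Real.exp B)
            ∂(Measure.pi fun _ : Fin T => gaussianReal 0 1) := by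
          gcongr
          exact hB _
      _ ≤ _ := by
          rw [lintegral_mul_const _ ((hL k).pow_const 2), pow_succ]
          gcongr
          exact ih (by omega)

/-- If the likelihood ratio is bounded in `L²`, the two models overlap. -/
theorem le_lintegral_min_likelihoodRatio {m : (Fin d → ℝ) → ℝ} (hm : Measurable m) {B : ℝ}
    (hB : ∀ x, m x ^ 2 ≤ B / T) (hT : T ≠ 0) (x : Fin d → ℝ) :
    ENNReal.ofReal (Real.exp (-B) / 4) ≤ ∫⁻ v, min 1 (likelihoodRatio m T (x, v))
      ∂(Measure.pi fun _ : Fin T => gaussianReal 0 1) := by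
  have hL : Measurable fun v : Fin T → ℝ => likelihoodRatio m T (x, v) :=
    (measurable_likelihoodRatio hm T).comp measurable_prodMk_left
  have hTR : (T : ℝ) ≠ 0 := Nat.cast_ne_zero.2 hT
  have hB0 : 0 ≤ B := by
    have h := (sq_nonneg _).trans (hB 0)
    have hT' : (0 : ℝ) < T := by positivity
    by_contra! hneg
    exact absurd h (not_le.2 (div_neg_of_neg_of_pos hneg hT'))
  have h1 : ∫⁻ v, likelihoodRatio m T (x, v)
      ∂(Measure.pi fun _ : Fin T => gaussianReal 0 1) = 1 := by
    simpa using (lintegral_path hm x (G := fun _ => 1) measurable_const).symm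
  have h2 := lintegral_likelihoodRatio_sq_le (T := T) hm hB x T le_rfl
  rw [← ENNReal.ofReal_pow (Real.exp_nonneg _), ← Real.exp_nat_mul,
    mul_div_cancel₀ _ hTR] at h2
  -- The truncation level `K = 2 exp B` makes the tail term `K⁻¹ E L²` at most `1/2`, half of `E L =
  -- 1`.
  have hK : (1 : ℝ) ≤ 2 * Real.exp B := by linarith [Real.one_le_exp hB0]
  set K : ℝ≥0∞ := ENNReal.ofReal (2 * Real.exp B) with hKdef
  have hK1 : 1 ≤ K := by simpa [hKdef] using ENNReal.ofReal_le_ofReal hK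
  have hKtop : K ≠ ∞ := ENNReal.ofReal_ne_top
  have hK0 : K ≠ 0 := (zero_lt_one.trans_le hK1).ne'
  -- The first term dominates when `l ≤ K`, the second when `l ≥ K`.
  have hpt (l : ℝ≥0∞) : l ≤ K * min 1 l + K⁻¹ * l ^ 2 := by
    rcases le_total l K with hl | hl
    · refine le_add_right ?_
      rcases le_total 1 l with h | h
      · rwa [min_eq_left h, mul_one]
      · rw [min_eq_right h]
        exact le_mul_of_one_le_left' hK1
    · refine le_add_left ?_
      rw [sq, ← mul_assoc]
      refine le_mul_of_one_le_left' ?_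
      rw [← ENNReal.inv_mul_cancel hK0 hKtop]
      gcongr
  have h3 : (1 : ℝ≥0∞) ≤ K * ∫⁻ v, min 1 (likelihoodRatio m T (x, v))
      ∂(Measure.pi fun _ : Fin T => gaussianReal 0 1) + 2⁻¹ := by
    rw [← h1]
    refine (lintegral_mono fun v => hpt (likelihoodRatio m T (x, v))).trans ?_
    rw [lintegral_add_left ((measurable_const.min hL).const_mul _),
      lintegral_const_mul _ (measurable_const.min hL), lintegral_const_mul _ (hL.pow_const 2)]
    rw [h1]
    gcongr
    refine (mul_le_mul_right h2 _).trans_eq ?_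
    rw [hKdef, ← ENNReal.ofReal_inv_of_pos (by positivity), ← ENNReal.ofReal_mul (by positivity)]
    have : (2 * Real.exp B)⁻¹ * Real.exp B = 2⁻¹ := by
      have := Real.exp_ne_zero B
      field_simp
    rw [this, ENNReal.ofReal_inv_of_pos two_pos]
    simp
  have h4 : (2⁻¹ : ℝ≥0∞) ≤ K * ∫⁻ v, min 1 (likelihoodRatio m T (x, v))
      ∂(Measure.pi fun _ : Fin T => gaussianReal 0 1) := by
    have := tsub_le_iff_right.2 h3
    rwa [ENNReal.one_sub_inv_two] at this
  have h5 : ENNReal.ofReal (Real.exp (-B) / 4) = K⁻¹ * 2⁻¹ := by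
    rw [hKdef, ← ENNReal.ofReal_inv_of_pos (by positivity),
      show (2⁻¹ : ℝ≥0∞) = ENNReal.ofReal 2⁻¹ by
        rw [ENNReal.ofReal_inv_of_pos two_pos]; simp,
      ← ENNReal.ofReal_mul (by positivity), Real.exp_neg]
    congr 1
    field_simp
    norm_num
  rw [h5]
  calc K⁻¹ * 2⁻¹ ≤ K⁻¹ * (K * _) := mul_le_mul_right h4 _
    _ = _ := by rw [← mul_assoc, ENNReal.inv_mul_cancel hK0 hKtop, one_mul]

/-! ### A lower bound for the law of the regressors on the unit cube -/

/-- Insert a new most recent value `y` into the vector `x` of lagged values. -/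
def push (y : ℝ) (x : Fin d → ℝ) (i : Fin d) : ℝ :=
  if i.val = 0 then y else x ⟨i.val - 1, by omega⟩

/-- The lagged values after `k` steps that produced the first `k` entries of `z`. -/
def splice (k : ℕ) (z x : Fin d → ℝ) (i : Fin d) : ℝ :=
  if i.val < k then z i else x ⟨i.val - k, by omega⟩

theorem measurable_push : Measurable fun p : ℝ × (Fin d → ℝ) => push p.1 p.2 := by
  refine measurable_pi_iff.2 fun i => ?_
  unfold push
  split_ifs <;> fun_prop

theorem measurable_splice (k : ℕ) :
    Measurable fun p : (Fin d → ℝ) × (Fin d → ℝ) => splice k p.1 p.2 := by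
  refine measurable_pi_iff.2 fun i => ?_
  unfold splice
  split_ifs <;> fun_prop

theorem splice_push (k : Fin d) (z x : Fin d → ℝ) (y : ℝ) :
    splice k z (push y x) = splice (k + 1) (Function.update z k y) x := by
  ext i
  rcases lt_trichotomy i k with h | rfl | h
  · have h' := Fin.lt_def.1 h
    simp only [splice, if_pos h', if_pos (Nat.lt_succ_of_lt h'), Function.update_of_ne h.ne]
  · simp [splice, push]
  · have h' := Fin.lt_def.1 h
    have h1 : ¬ i.val < k.val := by omega
    have h2 : ¬ i.val < k.val + 1 := by omega
    have h3 : ¬ i.val - k.val = 0 := by omega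
    simp only [splice, push, if_neg h1, if_neg h2, if_neg h3, Nat.sub_sub]

theorem lag_succ (z : Sample d T) (t : ℕ) (ht : t + 1 < T) :
    lag z ⟨t + 1, ht⟩ = push (z.2 ⟨t, by omega⟩) (lag z ⟨t, by omega⟩) := by
  ext i
  by_cases h0 : i.val = 0
  · simp [lag, push, h0]
  · by_cases h1 : i.val < t + 1
    · have h2 : i.val - 1 < t := by omega
      simp only [lag, push, h0, h1, h2, dif_pos, if_false]
      exact congrArg _ (Fin.ext (by simp only; omega))
    · have h2 : ¬ i.val - 1 < t := by omega
      simp only [lag, push, h0, h1, h2, dif_neg, if_false, not_false_eq_true]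
      exact congrArg _ (Fin.ext (by simp only; omega))

/-- Lebesgue measure on the unit interval. -/
noncomputable def unitMeasure : Measure ℝ := volume.restrict (Set.Icc 0 1)

instance : IsProbabilityMeasure unitMeasure := ⟨by simp [unitMeasure]⟩

theorem pi_unitMeasure :
    (Measure.pi fun _ : Fin d => unitMeasure) = volume.restrict (cube d) := by
  unfold unitMeasure cube
  rw [← Measure.restrict_pi_pi, volume_pi, ← Set.pi_univ_Icc]
  rfl

/-- The Markov property: the regressor at `t` ignores the noise at `t`, which can therefore be
resampled independently of it. -/
theorem lintegral_lag_succ {m : (Fin d → ℝ) → ℝ} (hm : Measurable m) (x : Fin d → ℝ)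
    {h : (Fin d → ℝ) → ℝ≥0∞} (hh : Measurable h) (t : ℕ) (ht : t + 1 < T) :
    ∫⁻ v, h (lag (x, path m x v) ⟨t + 1, ht⟩) ∂(Measure.pi fun _ : Fin T => gaussianReal 0 1)
      = ∫⁻ v, ∫⁻ w, h (push (m (lag (x, path m x v) ⟨t, by omega⟩) + w)
          (lag (x, path m x v) ⟨t, by omega⟩)) ∂(gaussianReal 0 1)
          ∂(Measure.pi fun _ : Fin T => gaussianReal 0 1) := by
  have hp : Measurable fun v : Fin T → ℝ => (x, path m x v) :=
    measurable_const.prodMk ((measurable_path hm).comp measurable_prodMk_left)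
  rw [← lintegral_pi_update _ (⟨t, by omega⟩ : Fin T)
    (F := fun v => h (lag (x, path m x v) ⟨t + 1, ht⟩))
    (hh.comp ((measurable_lag _).comp hp))]
  refine lintegral_congr fun v => lintegral_congr fun w => ?_
  rw [lag_succ]
  simp only
  rw [path_eq, Function.update_self,
    lag_congr (y := path m x (Function.update v _ w)) (y' := path m x v)]
  exact fun s hs => path_update m x v w _ s hs

/-- Over `k` steps, the `k` newest entries may be replaced by independent uniform variables at the
cost of `pdfBound B` each. -/
theorem le_lintegral_lag_add {m : (Fin d → ℝ) → ℝ} (hm : Measurable m) {B : ℝ}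
    (hB : ∀ x, |m x| ≤ B) (x : Fin d → ℝ) {h : (Fin d → ℝ) → ℝ≥0∞} (hh : Measurable h)
    (k : ℕ) (hk : k ≤ d) (t : ℕ) (ht : t + k < T) :
    pdfBound B ^ k * ∫⁻ v, ∫⁻ z, h (splice k z (lag (x, path m x v) ⟨t, by omega⟩))
        ∂(Measure.pi fun _ : Fin d => unitMeasure)
        ∂(Measure.pi fun _ : Fin T => gaussianReal 0 1)
      ≤ ∫⁻ v, h (lag (x, path m x v) ⟨t + k, ht⟩)
        ∂(Measure.pi fun _ : Fin T => gaussianReal 0 1) := by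
  induction k generalizing t with
  | zero =>
    have hs (z x' : Fin d → ℝ) : splice 0 z x' = x' := by ext i; simp [splice]
    simp [hs]
  | succ k ih =>
    have hsp (k : ℕ) : Measurable fun p : (Fin d → ℝ) × (Fin d → ℝ) => h (splice k p.2 p.1) :=
      hh.comp ((measurable_splice k).comp measurable_swap)
    let F : (Fin d → ℝ) → ℝ≥0∞ := fun x' => ∫⁻ z, h (splice k z x')
      ∂(Measure.pi fun _ : Fin d => unitMeasure)
    have hF : Measurable F := (hsp k).lintegral_prod_right'
    have hpush (x' : Fin d → ℝ) : Measurable fun y => push y x' :=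
      measurable_push.comp measurable_prodMk_right
    -- The value produced at the first step becomes entry `k` after `k` further steps. `splice k`
    -- does not read coordinate `k` of `z`, which is free to carry it.
    have hswap (x' : Fin d → ℝ) : ∫⁻ y, F (push y x') ∂unitMeasure
        = ∫⁻ z, h (splice (k + 1) z x') ∂(Measure.pi fun _ : Fin d => unitMeasure) := by
      have hz : Measurable fun z : Fin d → ℝ => h (splice (k + 1) z x') :=
        hh.comp ((measurable_splice (k + 1)).comp measurable_prodMk_right)
      rw [← lintegral_pi_update unitMeasure (⟨k, hk⟩ : Fin d) hz, lintegral_lintegral_swap]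
      · refine lintegral_congr fun z => lintegral_congr fun y => ?_
        rw [← splice_push ⟨k, hk⟩]
      · exact (hh.comp ((measurable_splice k).comp (measurable_snd.prodMk
          ((hpush x').comp measurable_fst)))).aemeasurable
    have hmeas : Measurable fun v : Fin T → ℝ =>
        ∫⁻ z, h (splice (k + 1) z (lag (x, path m x v) ⟨t, by omega⟩))
          ∂(Measure.pi fun _ : Fin d => unitMeasure) :=
      ((hsp (k + 1)).lintegral_prod_right').comp ((measurable_lag _).comp
        (measurable_const.prodMk ((measurable_path hm).comp measurable_prodMk_left)))
    have hidx : (⟨t + (k + 1), ht⟩ : Fin T) = ⟨t + 1 + k, by omega⟩ := Fin.ext (by simp only; omega)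
    rw [hidx]
    refine le_trans ?_ (ih (by omega) (t + 1) (by omega))
    rw [pow_succ, mul_assoc]
    gcongr
    rw [lintegral_lag_succ hm x hF t (by omega), ← lintegral_const_mul _ hmeas]
    refine lintegral_mono fun v => ?_
    rw [← hswap]
    exact le_lintegral_gaussian_shift (hB _)
      (f := fun y => F (push y (lag (x, path m x v) ⟨t, by omega⟩))) (hF.comp (hpush _))

theorem le_lintegral_lag {m : (Fin d → ℝ) → ℝ} (hm : Measurable m) {B : ℝ}
    (hB : ∀ x, |m x| ≤ B) (x : Fin d → ℝ) {h : (Fin d → ℝ) → ℝ≥0∞} (hh : Measurable h)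
    (t : Fin T) (ht : d ≤ t.val) :
    pdfBound B ^ d * ∫⁻ z in cube d, h z ≤ ∫⁻ v, h (lag (x, path m x v) t)
      ∂(Measure.pi fun _ : Fin T => gaussianReal 0 1) := by
  have key := le_lintegral_lag_add (T := T) hm hB x hh d le_rfl (t.val - d) (by omega)
  have hidx : (⟨t.val - d + d, by omega⟩ : Fin T) = t := Fin.ext (by simp only; omega)
  have hs (z x' : Fin d → ℝ) : splice d z x' = z := by ext i; simp [splice]
  rw [hidx] at key
  simpa [hs, pi_unitMeasure] using key

theorem lintegral_law (ν : Measure (Fin d → ℝ)) [IsProbabilityMeasure ν] {m : (Fin d → ℝ) → ℝ}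
    (hm : Measurable m) {G : Sample d T → ℝ≥0∞} (hG : Measurable G) :
    ∫⁻ z, G z ∂(law ν m T)
      = ∫⁻ x, ∫⁻ v, G (x, path m x v) ∂(Measure.pi fun _ : Fin T => gaussianReal 0 1) ∂ν := by
  have hp : Measurable fun ω : (Fin d → ℝ) × (Fin T → ℝ) => (ω.1, path m ω.1 ω.2) :=
    measurable_fst.prodMk (measurable_path hm)
  rw [law, lintegral_map hG hp]
  exact lintegral_prod _ (hG.comp hp).aemeasurable

theorem isProbabilityMeasure_law (ν : Measure (Fin d → ℝ)) [IsProbabilityMeasure ν]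
    {m : (Fin d → ℝ) → ℝ} (hm : Measurable m) : IsProbabilityMeasure (law ν m T) :=
  Measure.isProbabilityMeasure_map (measurable_fst.prodMk (measurable_path hm)).aemeasurable

theorem le_lintegral_law_lag (ν : Measure (Fin d → ℝ)) [IsProbabilityMeasure ν]
    {m : (Fin d → ℝ) → ℝ} (hm : Measurable m) {B : ℝ} (hB : ∀ x, |m x| ≤ B)
    {h : (Fin d → ℝ) → ℝ≥0∞} (hh : Measurable h) (t : Fin T) (ht : d ≤ t.val) :
    pdfBound B ^ d * ∫⁻ z in cube d, h z ≤ ∫⁻ z, h (lag z t) ∂(law ν m T) := by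
  rw [lintegral_law ν hm (G := fun z => h (lag z t)) (hh.comp (measurable_lag t))]
  calc _ = ∫⁻ _, (pdfBound B ^ d * ∫⁻ z in cube d, h z) ∂ν := by simp
    _ ≤ _ := lintegral_mono fun x => le_lintegral_lag hm hB x hh t ht

/-! ### Lower bounds for the risk -/

/-- The squared `L²([0,1]^d)` error of the estimate computed from the sample `p`. -/
noncomputable def cubeError (f : Sample d T → (Fin d → ℝ) → ℝ) (m : (Fin d → ℝ) → ℝ)
    (p : Sample d T) : ℝ≥0∞ :=
  ∫⁻ x in cube d, ENNReal.ofReal ((f p x - m x) ^ 2)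

theorem measurableSet_cube : MeasurableSet (cube d) := measurableSet_Icc

theorem measurable_cubeError {f : Sample d T → (Fin d → ℝ) → ℝ} (hf : IsEstimator f)
    {m : (Fin d → ℝ) → ℝ} (hm : Measurable m) : Measurable (cubeError f m) := by
  have hf' : Measurable fun p : Sample d T × (Fin d → ℝ) => f p.1 p.2 := hf
  have : Measurable fun p : Sample d T × (Fin d → ℝ) =>
      ENNReal.ofReal ((f p.1 p.2 - m p.2) ^ 2) :=
    ((hf'.sub (hm.comp measurable_snd)).pow_const 2).ennreal_ofReal
  exact this.lintegral_prod_right'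

/-- Because the copy `X*` is independent of the sample, the estimate is a fixed function when the
law of the regressors is bounded below. -/
theorem le_risk (ν : Measure (Fin d → ℝ)) [IsProbabilityMeasure ν] {m : (Fin d → ℝ) → ℝ}
    (hm : Measurable m) {B : ℝ} (hB : ∀ x, |m x| ≤ B) {f : Sample d T → (Fin d → ℝ) → ℝ}
    (hf : IsEstimator f) (hT : T ≠ 0) (hdT : 2 * d ≤ T) :
    2⁻¹ * pdfBound B ^ d * ∫⁻ p, cubeError f m p ∂(law ν m T) ≤ risk ν m f := by
  have := isProbabilityMeasure_law (T := T) ν hm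
  have hf' : Measurable fun p : Sample d T × (Fin d → ℝ) => f p.1 p.2 := hf
  have htar : Measurable (target m) := hm.indicator measurableSet_cube
  have hH : Measurable fun p : Sample d T × (Fin d → ℝ) =>
      ENNReal.ofReal ((f p.1 p.2 - target m p.2) ^ 2) :=
    ((hf'.sub (htar.comp measurable_snd)).pow_const 2).ennreal_ofReal
  have hHt (t : Fin T) : Measurable fun p : Sample d T × Sample d T =>
      ENNReal.ofReal ((f p.1 (lag p.2 t) - target m (lag p.2 t)) ^ 2) :=
    hH.comp (measurable_fst.prodMk ((measurable_lag t).comp measurable_snd))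
  have hHx (p : Sample d T) : Measurable fun x : Fin d → ℝ =>
      ENNReal.ofReal ((f p x - target m x) ^ 2) := hH.comp measurable_prodMk_left
  have hTtop : (T : ℝ≥0∞) ≠ ∞ := ENNReal.natCast_ne_top T
  have hT0 : (T : ℝ≥0∞) ≠ 0 := Nat.cast_ne_zero.2 hT
  rw [risk, lintegral_prod _
    ((Finset.measurable_sum _ fun t _ => hHt t).const_mul _).aemeasurable,
    ← lintegral_const_mul _ (measurable_cubeError hf hm)]
  refine lintegral_mono fun p => ?_
  have hm1 (t : Fin T) : Measurable fun q : Sample d T =>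
      ENNReal.ofReal ((f p (lag q t) - target m (lag q t)) ^ 2) := (hHx p).comp (measurable_lag t)
  have hcube : cubeError f m p
      = ∫⁻ x in cube d, ENNReal.ofReal ((f p x - target m x) ^ 2) :=
    setLIntegral_congr_fun measurableSet_cube fun x hx => by
      simp only [target, Set.indicator_of_mem hx]
  simp only
  rw [lintegral_const_mul _ (Finset.measurable_sum _ fun t _ => hm1 t),
    lintegral_finsetSum _ fun t _ => hm1 t]
  set c : ℝ≥0∞ := pdfBound B ^ d * cubeError f m p with hc
  have hcard : (Finset.univ.filter fun t : Fin T => d ≤ t.val).card = T - d := by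
    have h1 := Finset.card_filter_add_card_filter_not (s := (Finset.univ : Finset (Fin T)))
      (fun t => t.val < d)
    simp only [not_lt, Fin.card_filter_val_lt, Finset.card_univ, Fintype.card_fin] at h1
    omega
  calc 2⁻¹ * pdfBound B ^ d * cubeError f m p = (T : ℝ≥0∞)⁻¹ * (T * 2⁻¹ * c) := by
        rw [hc, ← mul_assoc, ← mul_assoc, ← mul_assoc, ENNReal.inv_mul_cancel hT0 hTtop, one_mul]
    -- Only times `t ≥ d` are kept; as `2 * d ≤ T`, they are at least half of all times.
    _ ≤ (T : ℝ≥0∞)⁻¹ * ((T - d : ℕ) * c) := by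
        gcongr
        rw [← div_eq_mul_inv]
        refine ENNReal.div_le_of_le_mul ?_
        exact_mod_cast (by omega : T ≤ (T - d) * 2)
    _ = (T : ℝ≥0∞)⁻¹ * ∑ t with d ≤ (t : Fin T).val, c := by
        rw [Finset.sum_const, hcard, nsmul_eq_mul]
    _ ≤ (T : ℝ≥0∞)⁻¹ * ∑ t with d ≤ (t : Fin T).val, ∫⁻ q,
          ENNReal.ofReal ((f p (lag q t) - target m (lag q t)) ^ 2) ∂(law ν m T) := by
        gcongr with t ht
        rw [hc, hcube]
        exact le_lintegral_law_lag ν hm hB (hHx p) t (by simpa using ht)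
    _ ≤ _ := by
        gcongr
        exact Finset.filter_subset _ _

/-- Pointwise, `a² + (a - b)² - b²/2 = (2a - b)²/2 ≥ 0`; integrate with `b = θ φ` and `‖φ‖ = 1`. -/
theorem le_cubeError_add {φ : (Fin d → ℝ) → ℝ} (hφ : Measurable φ)
    (hφ1 : ∫⁻ x in cube d, ENNReal.ofReal (φ x ^ 2) = 1) {θ : ℝ}
    {f : Sample d T → (Fin d → ℝ) → ℝ} (hf : IsEstimator f) (p : Sample d T) :
    ENNReal.ofReal (θ ^ 2 / 2)
      ≤ cubeError f (fun _ => 0) p + cubeError f (fun x => θ * φ x) p := by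
  have hfp : Measurable (f p) := Measurable.of_uncurry_left hf
  rw [cubeError, cubeError, ← lintegral_add_left
    (f := fun x => ENNReal.ofReal ((f p x - 0) ^ 2)) ((hfp.sub measurable_const).pow_const 2).ennreal_ofReal]
  calc ENNReal.ofReal (θ ^ 2 / 2)
      = ∫⁻ x in cube d, ENNReal.ofReal (θ ^ 2 / 2) * ENNReal.ofReal (φ x ^ 2) := by
        rw [lintegral_const_mul _ (hφ.pow_const 2).ennreal_ofReal, hφ1, mul_one]
    _ ≤ _ := by
        refine lintegral_mono fun x => ?_
        rw [← ENNReal.ofReal_mul (by positivity),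
          ← ENNReal.ofReal_add (by positivity) (by positivity)]
        refine ENNReal.ofReal_le_ofReal ?_
        nlinarith [sq_nonneg (2 * f p x - θ * φ x)]

/-- Two-point lower bound for the maximal risk. -/
theorem le_risk_add_risk (ν : Measure (Fin d → ℝ)) [IsProbabilityMeasure ν]
    {φ : (Fin d → ℝ) → ℝ} (hφ : Measurable φ)
    (hφ1 : ∫⁻ x in cube d, ENNReal.ofReal (φ x ^ 2) = 1) {B : ℝ} (hB : ∀ x, |φ x| ≤ B)
    {f : Sample d T → (Fin d → ℝ) → ℝ} (hf : IsEstimator f) (hT : T ≠ 0) (hdT : 2 * d ≤ T) :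
    2⁻¹ * pdfBound B ^ d * (ENNReal.ofReal ((T : ℝ)⁻¹ / 2) *
        ENNReal.ofReal (Real.exp (-B ^ 2) / 4))
      ≤ risk ν (fun _ => 0) f + risk ν (fun x => (√T)⁻¹ * φ x) f := by
  have hB0 : 0 ≤ B := (abs_nonneg _).trans (hB 0)
  have hTpos : (0 : ℝ) < T := by positivity
  have hT1 : (1 : ℝ) ≤ T := by exact_mod_cast Nat.one_le_iff_ne_zero.2 hT
  have hθ : ((√(T : ℝ))⁻¹) ^ 2 = (T : ℝ)⁻¹ := by rw [inv_pow, Real.sq_sqrt hTpos.le]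
  have hθ1 : |(√(T : ℝ))⁻¹| ≤ 1 := by
    rw [abs_of_nonneg (by positivity)]
    exact inv_le_one_of_one_le₀ (Real.one_le_sqrt.2 hT1)
  set m : (Fin d → ℝ) → ℝ := fun x => (√T)⁻¹ * φ x with hmdef
  have hm : Measurable m := hφ.const_mul _
  have hm0 : Measurable fun _ : Fin d → ℝ => (0 : ℝ) := measurable_const
  have hmB (x : Fin d → ℝ) : |m x| ≤ B := by
    rw [hmdef, abs_mul]
    calc _ ≤ 1 * B := mul_le_mul hθ1 (hB x) (abs_nonneg _) zero_le_one
      _ = B := one_mul B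
  have hmsq (x : Fin d → ℝ) : m x ^ 2 ≤ B ^ 2 / T := by
    rw [hmdef, mul_pow, hθ, div_eq_inv_mul]
    exact mul_le_mul_of_nonneg_left (sq_le_sq' (abs_le.1 (hB x)).1 (abs_le.1 (hB x)).2)
      (by positivity)
  have hE0 := measurable_cubeError hf hm0
  have hE1 := measurable_cubeError hf hm
  have hL := measurable_likelihoodRatio (T := T) hm T
  have h0 := le_risk ν (B := B) hm0 (by simpa using hB0) hf hT hdT
  have h1 := le_risk ν hm hmB hf hT hdT
  refine le_trans ?_ (add_le_add h0 h1)
  rw [← mul_add]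
  gcongr
  rw [lintegral_law ν hm0 hE0, lintegral_law ν hm hE1]
  simp_rw [path_zero]
  have hpath (x : Fin d → ℝ) := lintegral_path (T := T) hm x
    (G := fun v => cubeError f m (x, v)) (hE1.comp measurable_prodMk_left)
  simp_rw [hpath]
  rw [← lintegral_add_left hE0.lintegral_prod_right']
  calc _ = ∫⁻ _, ENNReal.ofReal ((T : ℝ)⁻¹ / 2) *
        ENNReal.ofReal (Real.exp (-B ^ 2) / 4) ∂ν := by simp
    _ ≤ _ := lintegral_mono fun x => ?_
  have hLx : Measurable fun v : Fin T → ℝ => likelihoodRatio m T (x, v) :=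
    hL.comp measurable_prodMk_left
  have hE0x : Measurable fun v : Fin T → ℝ => cubeError f (fun _ => 0) (x, v) :=
    hE0.comp measurable_prodMk_left
  rw [← lintegral_add_left hE0x]
  calc _ ≤ ENNReal.ofReal ((T : ℝ)⁻¹ / 2) * ∫⁻ v, min 1 (likelihoodRatio m T (x, v))
          ∂(Measure.pi fun _ : Fin T => gaussianReal 0 1) := by
        gcongr
        exact le_lintegral_min_likelihoodRatio hm hmsq hT x
    _ = ∫⁻ v, ENNReal.ofReal ((T : ℝ)⁻¹ / 2) * min 1 (likelihoodRatio m T (x, v))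
          ∂(Measure.pi fun _ : Fin T => gaussianReal 0 1) :=
        (lintegral_const_mul _ (measurable_const.min hLx)).symm
    _ ≤ _ := by
        refine lintegral_mono fun v => ?_
        have hE := le_cubeError_add hφ hφ1 (θ := (√(T : ℝ))⁻¹) hf (x, v)
        rw [hθ] at hE
        -- In `min(1, L)`, the bound by `1` leaves the error under `m = 0`, and the bound by `L`
        -- turns the other error into its mean under the perturbed model.
        calc _ ≤ (cubeError f (fun _ => 0) (x, v) + cubeError f m (x, v))
              * min 1 (likelihoodRatio m T (x, v)) := by gcongr
          _ ≤ _ := by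
            rw [add_mul]
            gcongr
            · exact mul_le_of_le_one_right' (min_le_left _ _)
            · exact min_le_right _ _

/-! ### The model class -/

theorem mul_mem_modelClass {Φ : Set ((Fin d → ℝ) → ℝ)} {φ : (Fin d → ℝ) → ℝ} (hφΦ : φ ∈ Φ)
    (hφ : Measurable φ) {c : Fin (d + 1) → ℝ} (hc : ∀ i, 0 ≤ c i) (hB : ∀ x, |φ x| ≤ c 0)
    {n : ℕ} (hn : 1 ≤ n) {C : ℝ} (hC : 1 ≤ C) {θ : ℝ} (hθ : |θ| ≤ 1) :
    (fun x => θ * φ x) ∈ modelClass Φ c n C := by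
  have hC0 : 0 ≤ C := zero_le_one.trans hC
  refine ⟨⟨hφ.const_mul _, fun x => ?_⟩, ?_⟩
  · have h1 : |θ * φ x| ≤ c 0 := by
      rw [abs_mul]
      calc _ ≤ 1 * c 0 := mul_le_mul hθ (hB x) (abs_nonneg _) zero_le_one
        _ = c 0 := one_mul _
    have h2 : 0 ≤ ∑ i : Fin d, c i.succ * |x i| :=
      Finset.sum_nonneg fun i _ => mul_nonneg (hc _) (abs_nonneg _)
    linarith
  -- One term carries the function and the remaining `n - 1` have weight zero; `1 ≤ C` admits the
  -- identity matrix.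
  · refine ⟨fun _ => 1, fun _ => 0, fun i => if i = ⟨0, hn⟩ then θ else 0, fun _ => φ,
      fun i => ⟨hφΦ, by simp, by simpa using hC, fun j k => ?_, fun _ => by simpa using hC0, ?_⟩, ?_⟩
    · simp only [Matrix.one_apply]
      split_ifs <;> simp [hC, hC0]
    · simp only
      split_ifs
      · exact hθ.trans hC
      · simpa using hC0
    · ext x
      simp

theorem setLIntegral_sq_eq_one {φ : (Fin d → ℝ) → ℝ} {s : Set (Fin d → ℝ)}
    (h : eLpNorm φ 2 (volume.restrict s) = 1) : ∫⁻ x in s, ENNReal.ofReal (φ x ^ 2) = 1 := by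
  have h2 := eLpNorm_nnreal_pow_eq_lintegral (f := φ) (μ := volume.restrict s) (p := 2) two_ne_zero
  rw [show ((2 : NNReal) : ℝ≥0∞) = 2 by norm_num, h] at h2
  rw [show (1 : ℝ≥0∞) = 1 ^ ((2 : NNReal) : ℝ) by simp, h2]
  refine lintegral_congr fun x => ?_
  rw [← sq_abs, ENNReal.ofReal_pow (abs_nonneg _), ← Real.enorm_eq_ofReal_abs]
  norm_num

end NonlinearAR

/-! ### The minimax lower bound -/

theorem mainTheorem5 (d : ℕ) (hd : 1 ≤ d)
    (ν : Measure (Fin d → ℝ)) [IsProbabilityMeasure ν]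
    (hν : Integrable (fun x : Fin d → ℝ => ‖WithLp.toLp 2 x‖) ν)
    (c : Fin (d + 1) → ℝ) (hc : ∀ i, 0 < c i) (hc1 : ∑ i : Fin d, c i.succ < 1)
    (Φ : Set ((Fin d → ℝ) → ℝ))
    (hΦ : ∀ φ ∈ Φ, Measurable φ ∧ eLpNorm φ 2 (volume.restrict (NonlinearAR.cube d)) = 1)
    (n : ℕ) (hn : 1 ≤ n) (C : ℝ) (hC : 1 ≤ C)
    (hφ : ∃ φ ∈ Φ, tsupport φ ⊆ NonlinearAR.cube d ∧ ∀ x ∈ NonlinearAR.cube d, |φ x| ≤ c 0) :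
    0 < liminf (fun T : ℕ =>
      (T : ℝ≥0∞) * NonlinearAR.minimaxRisk ν (NonlinearAR.modelClass Φ c n C) T) atTop := by
  obtain ⟨φ, hφΦ, hsupp, hbound⟩ := hφ
  obtain ⟨hφm, hφn⟩ := hΦ φ hφΦ
  have hφ1 := NonlinearAR.setLIntegral_sq_eq_one hφn
  -- The bound is needed on the whole space, since the regressors also leave the cube.
  have hB (x : Fin d → ℝ) : |φ x| ≤ c 0 := by
    by_cases hx : x ∈ NonlinearAR.cube d
    · exact hbound x hx
    · rw [image_eq_zero_of_notMem_tsupport fun h => hx (hsupp h), abs_zero]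
      exact (hc 0).le
  -- The three halves come, in order, from bounding the maximum of two risks by their mean, from
  -- discarding the times `t < d`, and from the separation `θ²/2` with `θ² = 1/T`.
  set δ : ℝ≥0∞ := 2⁻¹ * (2⁻¹ * NonlinearAR.pdfBound (c 0) ^ d *
    (2⁻¹ * ENNReal.ofReal (Real.exp (-(c 0) ^ 2) / 4))) with hδ
  have hδ0 : 0 < δ := by
    have h1 : NonlinearAR.pdfBound (c 0) ^ d ≠ 0 := pow_ne_zero _ (NonlinearAR.pdfBound_pos _).ne'
    have h2 : ENNReal.ofReal (Real.exp (-(c 0) ^ 2) / 4) ≠ 0 := by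
      rw [← pos_iff_ne_zero, ENNReal.ofReal_pos]
      positivity
    have h3 : (2⁻¹ : ℝ≥0∞) ≠ 0 := by simp
    exact pos_iff_ne_zero.2 (mul_ne_zero h3 (mul_ne_zero (mul_ne_zero h3 h1) (mul_ne_zero h3 h2)))
  refine hδ0.trans_le (le_liminf_of_le (by isBoundedDefault) ?_)
  filter_upwards [eventually_ge_atTop (2 * d)] with T hdT
  have hT : T ≠ 0 := by omega
  have hTpos : (0 : ℝ) < T := by positivity
  have hT1 : (1 : ℝ) ≤ T := by exact_mod_cast Nat.one_le_iff_ne_zero.2 hT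
  have hTtop : (T : ℝ≥0∞) ≠ ∞ := ENNReal.natCast_ne_top T
  have hT0 : (T : ℝ≥0∞) ≠ 0 := Nat.cast_ne_zero.2 hT
  suffices h : (T : ℝ≥0∞)⁻¹ * δ
      ≤ NonlinearAR.minimaxRisk ν (NonlinearAR.modelClass Φ c n C) T by
    calc δ = T * ((T : ℝ≥0∞)⁻¹ * δ) := by
          rw [← mul_assoc, ENNReal.mul_inv_cancel hT0 hTtop, one_mul]
      _ ≤ _ := mul_le_mul_right h _
  refine le_iInf₂ fun f hf => ?_
  have hc' (i : Fin (d + 1)) : 0 ≤ c i := (hc i).le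
  have hθ1 : |(√(T : ℝ))⁻¹| ≤ 1 := by
    rw [abs_of_nonneg (by positivity)]
    exact inv_le_one_of_one_le₀ (Real.one_le_sqrt.2 hT1)
  have hmem0 : (fun _ => 0) ∈ NonlinearAR.modelClass Φ c n C := by
    simpa using NonlinearAR.mul_mem_modelClass hφΦ hφm hc' hB hn hC (θ := 0) (by simp)
  have hmem1 := NonlinearAR.mul_mem_modelClass hφΦ hφm hc' hB hn hC hθ1
  set S : ℝ≥0∞ := ⨆ m ∈ NonlinearAR.modelClass Φ c n C, NonlinearAR.risk ν m f
  have h0 : NonlinearAR.risk ν (fun _ => 0) f ≤ S :=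
    le_iSup₂ (f := fun m (_ : m ∈ NonlinearAR.modelClass Φ c n C) => NonlinearAR.risk ν m f) _ hmem0
  have h1 : NonlinearAR.risk ν (fun x => (√T)⁻¹ * φ x) f ≤ S :=
    le_iSup₂ (f := fun m (_ : m ∈ NonlinearAR.modelClass Φ c n C) => NonlinearAR.risk ν m f) _ hmem1
  have h2 := (NonlinearAR.le_risk_add_risk ν hφm hφ1 hB hf hT hdT).trans (add_le_add h0 h1)
  have hTinv : ENNReal.ofReal ((T : ℝ)⁻¹ / 2) = (T : ℝ≥0∞)⁻¹ * 2⁻¹ := by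
    rw [div_eq_mul_inv, ENNReal.ofReal_mul (by positivity), ENNReal.ofReal_inv_of_pos hTpos,
      ENNReal.ofReal_inv_of_pos two_pos]
    simp
  rw [hTinv, ← two_mul] at h2
  calc (T : ℝ≥0∞)⁻¹ * δ = 2⁻¹ * (2⁻¹ * NonlinearAR.pdfBound (c 0) ^ d *
        ((T : ℝ≥0∞)⁻¹ * 2⁻¹ * ENNReal.ofReal (Real.exp (-(c 0) ^ 2) / 4))) := by
        rw [hδ]; ring
    _ ≤ 2⁻¹ * (2 * S) := mul_le_mul_right h2 _
    _ = S := by rw [← mul_assoc, ENNReal.inv_mul_cancel two_ne_zero ENNReal.ofNat_ne_top, one_mul]
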